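/- Let $X$ and $Y$ be smooth (Hausdorff, second countable, boundaryless) manifolds of finite dimensions $n$ and $m$, let $\pi\colon X\to Y$ be a smooth surjective submersion, and let $v$ be a smooth vector field on $X$ with maximal flow $\Phi$; write $\mathcal T_X\subseteq\mathbb R\times X$ for the set of all $(t,x)$ for which $\Phi_t(x)$ is defined. The system $\frac{d}{dt}\Phi_t(x)=v(\Phi_t(x))$ is called *exactly lumpable for $\pi$* if there is a smooth vector field $\tilde v$ on $Y$ such that $$\frac{d}{dt}\Big|_{t=s}\pi(\Phi_t(x))=\tilde v\big(\pi(\Phi_s(x))\big)\qquad\text{for all }(s,x)\in\mathcal T_X .$$ The vertical distribution $\ker D\pi$ is called *invariant under the flow $\Phi$* if $(D\Phi_t)_x(\ker D\pi_x)\subseteq\ker D\pi_{\Phi_t(x)}$ for all $(t,x)\in\mathcal T_X$. If the system is exactly lumpable for $\pi$, then $\ker D\pi$ is invariant under $\Phi$. If moreover all fibres $\pi^{-1}(y)$, $y\in Y$, are connected, then the converse holds as well: the system is exactly lumpable for $\pi$ if and only if $\ker D\pi$ is invariant under $\Phi$. -/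

import Mathlib

open Set
open scoped Manifold ContDiff

noncomputable section

/-- A vector field on the manifold `X` is smooth if it is a smooth section of the tangent bundle. -/
def IsSmoothVectorField {n : ℕ} {X : Type*} [TopologicalSpace X]
    [ChartedSpace (EuclideanSpace ℝ (Fin n)) X] [IsManifold (𝓡 n) ∞ X]
    (v : (x : X) → TangentSpace (𝓡 n) x) : Prop :=
  ContMDiff (𝓡 n) (𝓡 n).tangent ∞ (fun x => (⟨x, v x⟩ : TangentBundle (𝓡 n) X))

/-- `γ` is an integral curve of `v` that starts at `x` and is defined (at least) on the open
interval `(a, b)` containing `0` and `t`. -/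
def IsIntegralCurveFrom {n : ℕ} {X : Type*} [TopologicalSpace X]
    [ChartedSpace (EuclideanSpace ℝ (Fin n)) X]
    (v : (x : X) → TangentSpace (𝓡 n) x) (x : X) (t : ℝ) (γ : ℝ → X) (a b : ℝ) : Prop :=
  0 ∈ Ioo a b ∧ t ∈ Ioo a b ∧ γ 0 = x ∧ IsMIntegralCurveOn γ v (Ioo a b)

/-- The domain of the (maximal) flow of `v`: all `(t, x)` such that the integral curve of `v`
starting at `x` exists up to time `t`. -/
def flowDomain {n : ℕ} {X : Type*} [TopologicalSpace X]
    [ChartedSpace (EuclideanSpace ℝ (Fin n)) X]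
    (v : (x : X) → TangentSpace (𝓡 n) x) : Set (ℝ × X) :=
  {p | ∃ (γ : ℝ → X) (a b : ℝ), IsIntegralCurveFrom v p.2 p.1 γ a b}

open Classical in
/-- The (maximal) flow `Φ_t(x)` of `v`: the value at time `t` of an integral curve of `v` starting
at `x`. For `(t, x)` outside `flowDomain v` the value is junk (we take `x`). -/
def flow {n : ℕ} {X : Type*} [TopologicalSpace X]
    [ChartedSpace (EuclideanSpace ℝ (Fin n)) X]
    (v : (x : X) → TangentSpace (𝓡 n) x) (t : ℝ) (x : X) : X :=
  if h : (t, x) ∈ flowDomain v then Classical.choose h t else x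

/-- The flow does not depend on the choice of the integral curve. -/
theorem flow_eq_of_isIntegralCurveFrom {n : ℕ} {X : Type*} [TopologicalSpace X] [T2Space X]
    [ChartedSpace (EuclideanSpace ℝ (Fin n)) X] [IsManifold (𝓡 n) ∞ X]
    {v : (x : X) → TangentSpace (𝓡 n) x} (hv : IsSmoothVectorField v)
    {x : X} {t : ℝ} {γ : ℝ → X} {a b : ℝ} (hγ : IsIntegralCurveFrom v x t γ a b) :
    flow v t x = γ t := by
  have h : (t, x) ∈ flowDomain v := ⟨γ, a, b, hγ⟩
  have : IsManifold (𝓡 n) 1 X := IsManifold.of_le (n := ∞) (by simp)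
  rw [flow, dif_pos h]
  obtain ⟨a', b', h0', ht', hx', hc'⟩ := Classical.choose_spec h
  obtain ⟨h0, ht, hx, hc⟩ := hγ
  have key : EqOn (Classical.choose h) γ (Ioo (max a' a) (min b' b)) := by
    refine isMIntegralCurveOn_Ioo_eqOn_of_contMDiff_boundaryless (I := 𝓡 n) (v := v) (t₀ := 0)
      ⟨max_lt h0'.1 h0.1, lt_min h0'.2 h0.2⟩ (ContMDiff.of_le hv (by simp)) ?_ ?_ ?_
    · exact hc'.mono (Ioo_subset_Ioo (le_max_left _ _) (min_le_left _ _))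
    · exact hc.mono (Ioo_subset_Ioo (le_max_right _ _) (min_le_right _ _))
    · exact hx'.trans hx.symm
  exact key ⟨max_lt ht'.1 ht.1, lt_min ht'.2 ht.2⟩

/-- The system `d/dt Φ_t = v ∘ Φ_t` is exactly (smoothly) lumpable for `π`: there is a smooth vector
field `v'` on `Y` such that `Θ_t = π ∘ Φ_t` satisfies `d/dt|_{t=s} Θ_t(x) = v' (Θ_s(x))` for all `x`
and all `s` for which `Φ_s(x)` is defined. -/
def IsExactlyLumpable (n m : ℕ) {X Y : Type*}
    [TopologicalSpace X] [ChartedSpace (EuclideanSpace ℝ (Fin n)) X]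
    [TopologicalSpace Y] [ChartedSpace (EuclideanSpace ℝ (Fin m)) Y] [IsManifold (𝓡 m) ∞ Y]
    (v : (x : X) → TangentSpace (𝓡 n) x) (π : X → Y) : Prop :=
  ∃ v' : (y : Y) → TangentSpace (𝓡 m) y, IsSmoothVectorField v' ∧
    ∀ (x : X) (s : ℝ), (s, x) ∈ flowDomain v →
      HasMFDerivAt 𝓘(ℝ, ℝ) (𝓡 m) (fun t => π (flow v t x)) s
        ((1 : ℝ →L[ℝ] ℝ).smulRight (v' (π (flow v s x))))

/-- The vertical distribution: the fibre at `x` is the kernel of `Dπ_x : T_x X → T_{π(x)} Y`. -/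
def verticalSpace (n m : ℕ) {X Y : Type*}
    [TopologicalSpace X] [ChartedSpace (EuclideanSpace ℝ (Fin n)) X]
    [TopologicalSpace Y] [ChartedSpace (EuclideanSpace ℝ (Fin m)) Y]
    (π : X → Y) (x : X) : Submodule ℝ (TangentSpace (𝓡 n) x) :=
  LinearMap.ker (mfderiv (𝓡 n) (𝓡 m) π x).toLinearMap

/-- A distribution `S` on `X` is invariant under the flow `Φ` of `v`: `(DΦ_t)_x` maps `S_x` into
`S_{Φ_t(x)}` for all `x` and `t` for which `Φ_t(x)` is defined. -/
def IsFlowInvariant {n : ℕ} {X : Type*}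
    [TopologicalSpace X] [ChartedSpace (EuclideanSpace ℝ (Fin n)) X]
    (v : (x : X) → TangentSpace (𝓡 n) x)
    (S : (x : X) → Submodule ℝ (TangentSpace (𝓡 n) x)) : Prop :=
  ∀ (t : ℝ) (x : X), (t, x) ∈ flowDomain v → ∀ w ∈ S x,
    mfderiv (𝓡 n) (𝓡 n) (flow v t) x w ∈ S (flow v t x)

end

/-!
# Exact lumpability and invariance of the vertical distribution

If the system is lumpable with reduced vector field `v'` and `Ψ` is the flow of `v'`, then `π`
carries orbits of `v` to orbits of `v'`, that is `π ∘ Φ_t = Ψ_t ∘ π` near every point where `Φ_t` is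
defined. Differentiating this identity shows that `DΦ_t` maps `ker Dπ` into `ker Dπ`
(`IsExactlyLumpable.isFlowInvariant`).

Conversely, let `ker Dπ` be invariant. Near a point `x₀` all `Φ_t` with `|t| < ε` are defined, and
the derivative of `π ∘ Φ_t` vanishes along every path in the fibre of `x₀`. Hence `π ∘ Φ_t` is
constant on the fibre near `x₀`, and differentiating in `t` at `0` shows that the projected velocity
`Dπ(v)` is locally constant along the fibres
(`eventually_mfderiv_apply_eq_of_isFlowInvariant`). On connected fibres it is constant, so it
descends to a vector field on `Y`, which is smooth because `π` has smooth local sections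
(`IsFlowInvariant.isExactlyLumpable`).

Two standard facts carry the argument.

* The domain of `Φ_t` is open and `Φ_t` is differentiable on it
  (`eventually_mem_flowDomain_and_mdifferentiableAt`), so that the derivative `DΦ_t` in the
  definition of invariance is the true one. Locally this is the differentiable dependence of the
  solutions of an ordinary differential equation on the initial value
  (`exists_differentiable_local_flow_of_contDiffAt`); the group law `flow_add` extends it to all
  times.
* A submersion is affine in suitable local coordinates (`ContDiffAt.exists_straightening`), which
  gives local sections (`exists_local_section`) and paths inside the fibres
  (`eventually_exists_path_in_fibre`).
-/

/-! ### Differentiable dependence on the initial value in Banach spaces -/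

/-- Two-sided Grönwall estimate for a curve which vanishes at time `0`. -/
theorem norm_le_gronwallBound_abs {F : Type*} [NormedAddCommGroup F] [NormedSpace ℝ F]
    {g g' : ℝ → F} {ε K δ : ℝ} (hg : ∀ t ∈ Ioo (-ε) ε, HasDerivAt g (g' t) t) (h0 : g 0 = 0)
    (bound : ∀ t ∈ Ioo (-ε) ε, ‖g' t‖ ≤ K * ‖g t‖ + δ) {t : ℝ} (ht : t ∈ Ioo (-ε) ε) :
    ‖g t‖ ≤ gronwallBound 0 K δ |t| := by
  -- the estimate for positive times, applied below to `g` and to the reversed curve `s ↦ g (-s)`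
  have key : ∀ h h' : ℝ → F, (∀ t ∈ Ioo (-ε) ε, HasDerivAt h (h' t) t) → h 0 = 0 →
      (∀ t ∈ Ioo (-ε) ε, ‖h' t‖ ≤ K * ‖h t‖ + δ) → ∀ t ∈ Ico 0 ε,
      ‖h t‖ ≤ gronwallBound 0 K δ t := by
    intro h h' hd h0 hb t ht
    have hsub : Icc 0 t ⊆ Ioo (-ε) ε := fun s hs =>
      ⟨by linarith [hs.1, hs.2, ht.1, ht.2], hs.2.trans_lt ht.2⟩
    simpa using norm_le_gronwallBound_of_norm_deriv_right_le (f := h) (f' := h') (δ := 0)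
      (a := 0) (b := t) (fun s hs => (hd s (hsub hs)).continuousAt.continuousWithinAt)
      (fun s hs => (hd s (hsub (Ico_subset_Icc_self hs))).hasDerivWithinAt) (by simp [h0])
      (fun s hs => hb s (hsub (Ico_subset_Icc_self hs))) t ⟨ht.1, le_rfl⟩
  rcases le_total 0 t with h | h
  · rw [abs_of_nonneg h]
    exact key g g' hg h0 bound t ⟨h, ht.2⟩
  · have hneg : ∀ s ∈ Ioo (-ε) ε, -s ∈ Ioo (-ε) ε := fun s hs => by
      constructor <;> linarith [hs.1, hs.2]
    rw [abs_of_nonpos h]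
    have := key (fun s => g (-s)) (fun s => -g' (-s))
      (fun s hs => by
        simpa [Function.comp_def] using (hg (-s) (hneg s hs)).scomp s (hasDerivAt_neg s))
      (by simpa using h0)
      (fun s hs => by simpa using bound (-s) (hneg s hs)) (-t) ⟨by linarith, by linarith [ht.1]⟩
    simpa using this

section LocalFlow

variable {E : Type*} [NormedAddCommGroup E] [NormedSpace ℝ E]

/-- First-order Taylor estimate with quadratic remainder on a convex set. -/
theorem Convex.norm_sub_sub_fderiv_le {f : E → E} {s : Set E} (hs : Convex ℝ s)
    {C : NNReal} (hf : ∀ x ∈ s, DifferentiableAt ℝ f x) (hC : LipschitzOnWith C (fderiv ℝ f) s)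
    {x y : E} (hx : x ∈ s) (hy : y ∈ s) :
    ‖f y - f x - fderiv ℝ f x (y - x)‖ ≤ C * ‖y - x‖ ^ 2 := by
  have hseg : segment ℝ x y ⊆ s := hs.segment_subset hx hy
  have := (convex_segment x y).norm_image_sub_le_of_norm_hasFDerivWithin_le' (f := f)
    (f' := fderiv ℝ f) (φ := fderiv ℝ f x) (C := C * ‖y - x‖)
    (fun z hz => (hf z (hseg hz)).hasFDerivAt.hasFDerivWithinAt)
    (fun z hz => by
      refine (hC.norm_sub_le (hseg hz) hx).trans ?_
      gcongr
      obtain ⟨θ, hθ, rfl⟩ := (segment_eq_image' ℝ x y ▸ hz)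
      simp only [add_sub_cancel_left, norm_smul, Real.norm_eq_abs, abs_of_nonneg hθ.1]
      exact mul_le_of_le_one_left (norm_nonneg _) hθ.2)
    (left_mem_segment ℝ x y) (right_mem_segment ℝ x y)
  linarith [sq (‖y - x‖)]

/-- A `C²` vector field on a Banach space has, near every point, a local flow that is
differentiable in the initial point. The derivative is the solution of the equation of variations:
solving the enlarged system `(x, A)' = (f x, f'(x) ∘ A)` yields both the flow and the candidate for
its derivative, and Grönwall's inequality shows that the candidate is the derivative. -/
theorem exists_differentiable_local_flow_of_contDiffAt [CompleteSpace E] {f : E → E} {x₀ : E}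
    (hf : ContDiffAt ℝ 2 f x₀) {u : Set E} (hu : u ∈ nhds x₀) :
    ∃ r > (0 : ℝ), ∃ ε > (0 : ℝ), ∃ α : E → ℝ → E, ∀ x ∈ Metric.ball x₀ r, α x 0 = x ∧
      ∀ t ∈ Ioo (-ε) ε, α x t ∈ u ∧ HasDerivAt (α x) (f (α x t)) t ∧
        DifferentiableAt ℝ (fun y => α y t) x := by
  -- the enlarged system
  let F : E × (E →L[ℝ] E) → E × (E →L[ℝ] E) := fun p => (f p.1, (fderiv ℝ f p.1).comp p.2)
  have hdf : ContDiffAt ℝ 1 (fderiv ℝ f) x₀ := hf.fderiv_right (by norm_num)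
  have hF : ContDiffAt ℝ 1 F (x₀, ContinuousLinearMap.id ℝ E) :=
    ((hf.of_le (by norm_num)).comp (x₀, ContinuousLinearMap.id ℝ E) contDiffAt_fst).prodMk
      ((hdf.comp (x₀, ContinuousLinearMap.id ℝ E) contDiffAt_fst).clm_comp contDiffAt_snd)
  obtain ⟨ε, hε, a, r, L, K, hr, hpl⟩ := IsPicardLindelof.of_contDiffAt_one hF
  obtain ⟨β, hβ, L', hL'⟩ :=
    (hpl 0).exists_forall_mem_closedBall_eq_hasDerivWithinAt_lipschitzOnWith
  have hcont : ContinuousOn (Function.uncurry β)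
      (Metric.closedBall (x₀, ContinuousLinearMap.id ℝ E) r ×ˢ Icc (0 - ε) (0 + ε)) :=
    continuousOn_prod_of_continuousOn_lipschitzOnWith _ L'
      (fun x hx => HasDerivWithinAt.continuousOn (hβ x hx).2) hL'
  -- a ball on which `f` is differentiable with bounded and Lipschitz derivative
  obtain ⟨C, s, hs, hC⟩ := hdf.exists_lipschitzOnWith
  have hfd : ∀ᶠ x in nhds x₀, DifferentiableAt ℝ f x :=
    (hf.eventually (by simp)).mono fun x hx => hx.differentiableAt (by norm_num)
  have hbd : ∀ᶠ x in nhds x₀, ‖fderiv ℝ f x‖ < ‖fderiv ℝ f x₀‖ + 1 :=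
    hdf.continuousAt.norm.eventually_lt_const (by linarith)
  obtain ⟨ρ, hρ, hball⟩ := Metric.eventually_nhds_iff_ball.1
    ((hfd.and hbd).and ((Filter.eventually_mem_set.2 hs).and (Filter.eventually_mem_set.2 hu)))
  have hxr : (x₀, ContinuousLinearMap.id ℝ E) ∈
      Metric.closedBall (x₀, ContinuousLinearMap.id ℝ E) (r : ℝ) :=
    Metric.mem_closedBall_self r.2
  have hnear : ∀ᶠ p in nhds ((x₀, ContinuousLinearMap.id ℝ E), (0 : ℝ)),
      (Function.uncurry β p).1 ∈ Metric.ball x₀ ρ := by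
    have hc := hcont.continuousAt (x := ((x₀, ContinuousLinearMap.id ℝ E), (0 : ℝ)))
      (prod_mem_nhds (Metric.closedBall_mem_nhds _ hr)
        (Icc_mem_nhds (by linarith) (by linarith)))
    refine (continuous_fst.continuousAt.comp hc).eventually (Metric.isOpen_ball.mem_nhds ?_)
    have : β (x₀, ContinuousLinearMap.id ℝ E) 0 = (x₀, ContinuousLinearMap.id ℝ E) := (hβ _ hxr).1
    simp [Function.uncurry, this, hρ]
  rw [nhds_prod_eq] at hnear
  obtain ⟨U, hU, V, hV, hUV⟩ := Filter.eventually_prod_iff.1 hnear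
  obtain ⟨r₁, hr₁, hr₁U⟩ := Metric.eventually_nhds_iff_ball.1 hU
  obtain ⟨ε₁, hε₁, hε₁V⟩ := Metric.eventually_nhds_iff_ball.1 hV
  have hin : ∀ x ∈ Metric.ball x₀ (min r r₁),
      (x, ContinuousLinearMap.id ℝ E) ∈
        Metric.closedBall (x₀, ContinuousLinearMap.id ℝ E) (r : ℝ) ∧
      U (x, ContinuousLinearMap.id ℝ E) := by
    intro x hx
    have hx' : dist x x₀ < r ∧ dist x x₀ < r₁ := lt_min_iff.1 hx
    refine ⟨?_, hr₁U _ ?_⟩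
    · simp [Prod.dist_eq, hx'.1.le]
    · simp [Prod.dist_eq, hx'.2]
  refine ⟨min r r₁, lt_min hr hr₁, min ε ε₁, lt_min hε hε₁,
    fun x t => (β (x, ContinuousLinearMap.id ℝ E) t).1, fun x hx => ?_⟩
  have hmem : ∀ t ∈ Ioo (-(min ε ε₁)) (min ε ε₁), t ∈ Ioo (0 - ε) (0 + ε) ∧ V t := by
    intro t ht
    have h1 : |t| < ε ∧ |t| < ε₁ := lt_min_iff.1 (abs_lt.2 ht)
    refine ⟨?_, hε₁V t (by simpa [Real.dist_eq] using h1.2)⟩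
    simpa using abs_lt.1 h1.1
  have hder : ∀ x ∈ Metric.ball x₀ (min r r₁), ∀ t ∈ Ioo (-(min ε ε₁)) (min ε ε₁),
      HasDerivAt (β (x, ContinuousLinearMap.id ℝ E))
        (F (β (x, ContinuousLinearMap.id ℝ E) t)) t := fun x hx t ht =>
    ((hβ _ (hin x hx).1).2 t (Ioo_subset_Icc_self (hmem t ht).1)).hasDerivAt
      (Icc_mem_nhds (hmem t ht).1.1 (hmem t ht).1.2)
  have hder₁ : ∀ x ∈ Metric.ball x₀ (min r r₁), ∀ t ∈ Ioo (-(min ε ε₁)) (min ε ε₁),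
      HasDerivAt (fun t => (β (x, ContinuousLinearMap.id ℝ E) t).1)
        (f (β (x, ContinuousLinearMap.id ℝ E) t).1) t := fun x hx t ht =>
    (hasFDerivAt_fst (𝕜 := ℝ) (E := E) (F := E →L[ℝ] E)).comp_hasDerivAt t (hder x hx t ht)
  have hder₂ : ∀ x ∈ Metric.ball x₀ (min r r₁), ∀ t ∈ Ioo (-(min ε ε₁)) (min ε ε₁),
      HasDerivAt (fun t => (β (x, ContinuousLinearMap.id ℝ E) t).2)
        ((fderiv ℝ f (β (x, ContinuousLinearMap.id ℝ E) t).1).comp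
          (β (x, ContinuousLinearMap.id ℝ E) t).2) t := fun x hx t ht =>
    (hasFDerivAt_snd (𝕜 := ℝ) (E := E) (F := E →L[ℝ] E)).comp_hasDerivAt t (hder x hx t ht)
  have hα : ∀ x ∈ Metric.ball x₀ (min r r₁), ∀ t ∈ Ioo (-(min ε ε₁)) (min ε ε₁),
      (β (x, ContinuousLinearMap.id ℝ E) t).1 ∈ Metric.ball x₀ ρ := fun x hx t ht =>
    hUV (hin x hx).2 (hmem t ht).2
  have hinit : ∀ x ∈ Metric.ball x₀ (min r r₁), β (x, ContinuousLinearMap.id ℝ E) 0 =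
      (x, ContinuousLinearMap.id ℝ E) := fun x hx => (hβ _ (hin x hx).1).1
  refine ⟨by simp [hinit x hx], fun t ht => ⟨(hball _ (hα x hx t ht)).2.2,
    hder₁ x hx t ht, ?_⟩⟩
  -- the error of the linear approximation is quadratic in the displacement
  have hquad : ∀ y ∈ Metric.ball x₀ (min r r₁),
      ‖(β (y, ContinuousLinearMap.id ℝ E) t).1 - (β (x, ContinuousLinearMap.id ℝ E) t).1
        - (β (x, ContinuousLinearMap.id ℝ E) t).2 (y - x)‖ ≤
      gronwallBound 0 (‖fderiv ℝ f x₀‖ + 1) (C * (L' * ‖y - x‖) ^ 2) |t| := by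
    intro y hy
    refine norm_le_gronwallBound_abs (ε := min ε ε₁)
      (g := fun t => (β (y, ContinuousLinearMap.id ℝ E) t).1 -
        (β (x, ContinuousLinearMap.id ℝ E) t).1 -
        (β (x, ContinuousLinearMap.id ℝ E) t).2 (y - x))
      (fun τ hτ => ((hder₁ y hy τ hτ).sub (hder₁ x hx τ hτ)).sub
        ((hder₂ x hx τ hτ).clm_apply (hasDerivAt_const τ (y - x)))) ?_ ?_ ht
    · simp [hinit x hx, hinit y hy]
    · intro τ hτ
      have hlip : ‖(β (y, ContinuousLinearMap.id ℝ E) τ).1 -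
          (β (x, ContinuousLinearMap.id ℝ E) τ).1‖ ≤ L' * ‖y - x‖ := by
        have := (hL' τ (Ioo_subset_Icc_self (hmem τ hτ).1)).norm_sub_le (hin y hy).1 (hin x hx).1
        refine (norm_fst_le _).trans (this.trans ?_)
        simp
      set p := (β (y, ContinuousLinearMap.id ℝ E) τ).1
      set q := (β (x, ContinuousLinearMap.id ℝ E) τ).1 with hq
      set A := (β (x, ContinuousLinearMap.id ℝ E) τ).2 with hA
      have hqs := hball _ (hα x hx τ hτ)
      have htay := (convex_ball x₀ ρ).norm_sub_sub_fderiv_le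
        (fun z hz => (hball z hz).1.1) (hC.mono fun z hz => (hball z hz).2.1)
        (hα x hx τ hτ) (hα y hy τ hτ)
      have hsplit : f p - f q - ((fderiv ℝ f q).comp A (y - x) + A 0) =
          (f p - f q - fderiv ℝ f q (p - q)) + fderiv ℝ f q (p - q - A (y - x)) := by
        simp only [map_sub, map_zero, ContinuousLinearMap.comp_apply]
        abel
      calc ‖f p - f q - ((fderiv ℝ f q).comp A (y - x) + A 0)‖
          ≤ C * ‖p - q‖ ^ 2 + ‖fderiv ℝ f q‖ * ‖p - q - A (y - x)‖ := by
            rw [hsplit]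
            exact (norm_add_le _ _).trans (add_le_add htay (ContinuousLinearMap.le_opNorm _ _))
        _ ≤ C * (L' * ‖y - x‖) ^ 2 + (‖fderiv ℝ f x₀‖ + 1) * ‖p - q - A (y - x)‖ := by
            gcongr
            exact hqs.1.2.le
        _ = _ := add_comm _ _
  have hO : (fun y => (β (y, ContinuousLinearMap.id ℝ E) t).1 -
      (β (x, ContinuousLinearMap.id ℝ E) t).1 -
      (β (x, ContinuousLinearMap.id ℝ E) t).2 (y - x)) =O[nhds x] fun y => ‖y - x‖ ^ 2 := by
    refine Asymptotics.IsBigO.of_bound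
      (gronwallBound 0 (‖fderiv ℝ f x₀‖ + 1) (C * L' ^ 2) |t|) ?_
    filter_upwards [Metric.isOpen_ball.mem_nhds hx] with y hy
    refine (hquad y hy).trans (le_of_eq ?_)
    have hK : ‖fderiv ℝ f x₀‖ + 1 ≠ 0 := by positivity
    simp only [gronwallBound_of_K_ne_0 hK, norm_pow, norm_norm]
    ring
  have hA : DifferentiableAt ℝ
      (fun y => (β (x, ContinuousLinearMap.id ℝ E) t).2 (y - x)) x := by fun_prop
  refine (((hO.hasFDerivAt one_lt_two).differentiableAt.add hA).add_const
    (β (x, ContinuousLinearMap.id ℝ E) t).1).congr_of_eventuallyEq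
    (Filter.Eventually.of_forall fun y => ?_)
  simp

end LocalFlow

/-! ### The flow of a smooth vector field on a manifold -/

section Flow

variable {n : ℕ} {X : Type*} [TopologicalSpace X]
    [ChartedSpace (EuclideanSpace ℝ (Fin n)) X]
    {v : (x : X) → TangentSpace (𝓡 n) x}

theorem IsIntegralCurveFrom.mem_flowDomain {x : X} {t : ℝ} {γ : ℝ → X} {a b : ℝ}
    (hγ : IsIntegralCurveFrom v x t γ a b) : (t, x) ∈ flowDomain v :=
  ⟨γ, a, b, hγ⟩

theorem IsIntegralCurveFrom.of_mem {x : X} {t s : ℝ} {γ : ℝ → X} {a b : ℝ}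
    (hγ : IsIntegralCurveFrom v x t γ a b) (hs : s ∈ Ioo a b) : IsIntegralCurveFrom v x s γ a b :=
  ⟨hγ.1, hs, hγ.2.2⟩

variable [IsManifold (𝓡 n) ∞ X]

/-- Near every point, the flow exists for a uniform time and is differentiable in the initial
point. -/
theorem exists_uniform_time_mdifferentiableAt_flow [T2Space X] (hv : IsSmoothVectorField v)
    (x₀ : X) :
    ∃ U : Set X, IsOpen U ∧ x₀ ∈ U ∧ ∃ ε > (0 : ℝ), ∀ x ∈ U, ∀ t ∈ Ioo (-ε) ε,
      (t, x) ∈ flowDomain v ∧ MDifferentiableAt (𝓡 n) (𝓡 n) (flow v t) x := by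
  set φ := extChartAt (𝓡 n) x₀ with hφ
  -- the vector field in the chart `φ`, pulled back along the inverse of `φ`
  let w : EuclideanSpace ℝ (Fin n) → EuclideanSpace ℝ (Fin n) :=
    VectorField.mpullbackWithin 𝓘(ℝ, EuclideanSpace ℝ (Fin n)) (𝓡 n) φ.symm v (range (𝓡 n))
  have hw : ContDiffAt ℝ 2 w (φ x₀) := by
    have h := VectorField.contMDiffWithinAt_mpullbackWithin_extChartAt_symm (I := 𝓡 n) (m := 2)
      (n := 3) (V := v) (s := univ) (x := x₀)
      ((hv x₀).of_le ENat.LEInfty.out).contMDiffWithinAt uniqueMDiffOn_univ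
      (mem_univ _) (by norm_num)
    rw [preimage_univ, inter_univ, contMDiffWithinAt_vectorSpace_iff_contDiffWithinAt] at h
    exact h.contDiffAt (extChartAt_target_mem_nhds x₀)
  have hwv : ∀ p ∈ φ.target,
      mfderivWithin 𝓘(ℝ, EuclideanSpace ℝ (Fin n)) (𝓡 n) φ.symm (range (𝓡 n)) p (w p) =
        v (φ.symm p) := fun p hp =>
    (isInvertible_mfderivWithin_extChartAt_symm hp).self_apply_inverse _
  have hsymm : ∀ p ∈ φ.target, HasMFDerivAt 𝓘(ℝ, EuclideanSpace ℝ (Fin n)) (𝓡 n) φ.symm p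
      (mfderivWithin 𝓘(ℝ, EuclideanSpace ℝ (Fin n)) (𝓡 n) φ.symm (range (𝓡 n)) p) := by
    intro p hp
    refine (mdifferentiableWithinAt_extChartAt_symm hp).hasMFDerivWithinAt.hasMFDerivAt ?_
    simp
  obtain ⟨r, hr, ε, hε, α, hα⟩ := exists_differentiable_local_flow_of_contDiffAt hw
    (extChartAt_target_mem_nhds x₀)
  have hcurve : ∀ x ∈ φ.source ∩ φ ⁻¹' Metric.ball (φ x₀) r, ∀ t ∈ Ioo (-ε) ε,
      IsIntegralCurveFrom v x t (fun τ => φ.symm (α (φ x) τ)) (-ε) ε := by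
    rintro x ⟨hxs, hxb⟩ t ht
    refine ⟨⟨by linarith, hε⟩, ht, ?_, fun τ hτ => ?_⟩
    · change φ.symm (α (φ x) 0) = x
      rw [(hα _ hxb).1, φ.left_inv hxs]
    · obtain ⟨hτu, hτd, -⟩ := (hα _ hxb).2 τ hτ
      have := (hsymm _ hτu).comp τ hτd.hasFDerivAt.hasMFDerivAt
      refine HasMFDerivAt.hasMFDerivWithinAt (this.congr_mfderiv ?_)
      rw [← hwv _ hτu]
      exact ContinuousLinearMap.ext fun c : ℝ => map_smul
        (mfderivWithin 𝓘(ℝ, EuclideanSpace ℝ (Fin n)) (𝓡 n) φ.symm (range (𝓡 n)) (α (φ x) τ)) c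
        (w (α (φ x) τ))
  have hopen : IsOpen (φ.source ∩ φ ⁻¹' Metric.ball (φ x₀) r) :=
    (continuousOn_extChartAt x₀).isOpen_inter_preimage (isOpen_extChartAt_source x₀)
      Metric.isOpen_ball
  refine ⟨_, hopen, ⟨mem_extChartAt_source x₀, Metric.mem_ball_self hr⟩, ε, hε,
    fun x hx t ht => ⟨(hcurve x hx t ht).mem_flowDomain, ?_⟩⟩
  obtain ⟨htu, -, htd⟩ := (hα _ hx.2).2 t ht
  have hφx : MDifferentiableAt (𝓡 n) 𝓘(ℝ, EuclideanSpace ℝ (Fin n)) φ x :=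
    mdifferentiableAt_extChartAt (by simpa [hφ] using hx.1)
  have h := (hsymm _ htu).mdifferentiableAt.comp x
    (htd.mdifferentiableAt.comp x hφx)
  refine h.congr_of_eventuallyEq ?_
  filter_upwards [hopen.mem_nhds hx] with y hy
  exact flow_eq_of_isIntegralCurveFrom hv (hcurve y hy t ht)

variable [T2Space X]

/-- Along an orbit the flow is an integral curve. -/
theorem hasMFDerivAt_flow_time (hv : IsSmoothVectorField v) {t : ℝ} {x : X}
    (h : (t, x) ∈ flowDomain v) :
    HasMFDerivAt 𝓘(ℝ, ℝ) (𝓡 n) (fun s => flow v s x) t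
      ((1 : ℝ →L[ℝ] ℝ).smulRight (v (flow v t x))) := by
  obtain ⟨γ, a, b, hγ⟩ := h
  have hnhds : Ioo a b ∈ nhds t := Ioo_mem_nhds hγ.2.1.1 hγ.2.1.2
  rw [flow_eq_of_isIntegralCurveFrom hv hγ]
  refine ((hγ.2.2.2 t hγ.2.1).hasMFDerivAt hnhds).congr_of_eventuallyEq ?_
  filter_upwards [hnhds] with s hs
  exact flow_eq_of_isIntegralCurveFrom hv (hγ.of_mem hs)

/-- The group law of the flow: if `Φ_s(x)` and `Φ_t(Φ_s(x))` are defined, then so is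
`Φ_{s+t}(x)`, and it is equal to the latter. -/
theorem flow_add (hv : IsSmoothVectorField v) {s t : ℝ} {x : X} (hs : (s, x) ∈ flowDomain v)
    (ht : (t, flow v s x) ∈ flowDomain v) :
    (s + t, x) ∈ flowDomain v ∧ flow v (s + t) x = flow v t (flow v s x) := by
  obtain ⟨γ, a, b, hγ⟩ := hs
  obtain ⟨γ', a', b', hγ'⟩ := ht
  have hst := flow_eq_of_isIntegralCurveFrom hv hγ'
  have hγs := flow_eq_of_isIntegralCurveFrom hv hγ
  obtain ⟨h0', ht', hx', hc'⟩ := hγ'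
  obtain ⟨h0, hs, hx, hc⟩ := hγ
  -- the second curve, moved to start at time `s`
  have hshift : IsMIntegralCurveOn (γ' ∘ (· + -s)) v (Ioo (a' + s) (b' + s)) := by
    refine (hc'.comp_add (-s)).mono fun τ hτ => ?_
    exact ⟨by linarith [hτ.1], by linarith [hτ.2]⟩
  have hmem : s ∈ Ioo a b ∩ Ioo (a' + s) (b' + s) :=
    ⟨hs, by linarith [h0'.1], by linarith [h0'.2]⟩
  have hmeet : γ s = (γ' ∘ (· + -s)) s := by simp [hx', hγs]
  have hglue := isMIntegralCurveOn_piecewise (hv.of_le (by simp)) hc hshift hmem hmeet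
  have heq := eqOn_piecewise_of_isMIntegralCurveOn_Ioo (hv.of_le (by simp)) hc hshift hmem hmeet
  have hst_mem : s + t ∈ Ioo (a' + s) (b' + s) := ⟨by linarith [ht'.1], by linarith [ht'.2]⟩
  have hcurve : IsIntegralCurveFrom v x (s + t) (piecewise (Ioo a b) γ (γ' ∘ (· + -s)))
      (min a (a' + s)) (max b (b' + s)) := by
    refine ⟨⟨min_lt_of_left_lt h0.1, lt_max_of_lt_left h0.2⟩,
      ⟨min_lt_of_right_lt hst_mem.1, lt_max_of_lt_right hst_mem.2⟩, ?_, hglue.mono ?_⟩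
    · rw [piecewise_eq_of_mem _ _ _ h0, hx]
    · rw [Ioo_union_Ioo' (hmem.2.1.trans hmem.1.2) (hmem.1.1.trans hmem.2.2)]
  refine ⟨hcurve.mem_flowDomain, ?_⟩
  rw [flow_eq_of_isIntegralCurveFrom hv hcurve, heq hst_mem, hst]
  simp

/-- The flow domain is open in the initial point, and the flow is differentiable in the initial
point. Both properties propagate along an orbit, because the time interval is connected and by
the group law they persist over the uniform existence time near every point of the orbit. -/
theorem eventually_mem_flowDomain_and_mdifferentiableAt (hv : IsSmoothVectorField v)
    {t : ℝ} {x : X} (h : (t, x) ∈ flowDomain v) :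
    (∀ᶠ y in nhds x, (t, y) ∈ flowDomain v) ∧ MDifferentiableAt (𝓡 n) (𝓡 n) (flow v t) x := by
  obtain ⟨γ, a, b, hγ⟩ := h
  let P : ℝ → Prop := fun s => (∀ᶠ y in nhds x, (s, y) ∈ flowDomain v) ∧
    MDifferentiableAt (𝓡 n) (𝓡 n) (flow v s) x
  have hflow : ∀ s ∈ Ioo a b, flow v s x = γ s := fun s hs =>
    flow_eq_of_isIntegralCurveFrom hv (hγ.of_mem hs)
  have hP0 : P 0 := by
    obtain ⟨U, hU, hxU, ε, hε, hloc⟩ := exists_uniform_time_mdifferentiableAt_flow hv x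
    have h0 : (0 : ℝ) ∈ Ioo (-ε) ε := ⟨by linarith, hε⟩
    exact ⟨Filter.mem_of_superset (hU.mem_nhds hxU) fun y hy => (hloc y hy 0 h0).1,
      (hloc x hxU 0 h0).2⟩
  -- `P` passes from one time to another one if the orbit point has enough uniform existence time
  have hstep : ∀ (U : Set X) (ε : ℝ), IsOpen U → (∀ y ∈ U, ∀ t ∈ Ioo (-ε) ε,
      (t, y) ∈ flowDomain v ∧ MDifferentiableAt (𝓡 n) (𝓡 n) (flow v t) y) →
      ∀ s s' : ℝ, s ∈ Ioo a b → γ s ∈ U → s' - s ∈ Ioo (-ε) ε → P s → P s' := by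
    intro U ε hU hloc s s' hs hsU hε hPs
    have hnear : ∀ᶠ y in nhds x, (s, y) ∈ flowDomain v ∧ flow v s y ∈ U :=
      hPs.1.and (hPs.2.continuousAt.eventually_mem (hU.mem_nhds (by rwa [hflow s hs])))
    have hadd : ∀ᶠ y in nhds x, (s', y) ∈ flowDomain v ∧
        flow v s' y = flow v (s' - s) (flow v s y) := by
      filter_upwards [hnear] with y hy
      simpa using flow_add hv hy.1 (hloc _ hy.2 _ hε).1
    refine ⟨hadd.mono fun y hy => hy.1, ?_⟩
    refine ((hloc (flow v s x) (by rwa [hflow s hs]) _ hε).2.comp x hPs.2).congr_of_eventuallyEq ?_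
    exact hadd.mono fun y hy => hy.2
  have hiff : P 0 ↔ P t := by
    refine isPreconnected_Ioo.induction₂ (s := Ioo a b) (fun s s' => (P s ↔ P s')) (fun s hs => ?_)
      (fun _ _ _ _ _ _ h₁ h₂ => h₁.trans h₂) (fun _ _ _ _ h => h.symm) hγ.1 hγ.2.1
    obtain ⟨U, hU, hsU, ε, hε, hloc⟩ := exists_uniform_time_mdifferentiableAt_flow hv (γ s)
    have hcont : ContinuousWithinAt γ (Ioo a b) s := hγ.2.2.2.continuousWithinAt hs
    have hsub : ∀ᶠ s' in nhdsWithin s (Ioo a b), s' ∈ Ioo (s - ε) (s + ε) :=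
      nhdsWithin_le_nhds (Ioo_mem_nhds (by linarith) (by linarith))
    filter_upwards [hcont (hU.mem_nhds hsU), hsub, self_mem_nhdsWithin] with s' hs'U hs'ε hs'
    exact ⟨hstep U ε hU hloc s s' hs hsU ⟨by linarith [hs'ε.1], by linarith [hs'ε.2]⟩,
      hstep U ε hU hloc s' s hs' hs'U ⟨by linarith [hs'ε.2], by linarith [hs'ε.1]⟩⟩
  exact hiff.1 hP0

end Flow

/-! ### Straightening of submersions -/

/-- A map between finite-dimensional spaces with surjective derivative at a point becomes affine
after a local diffeomorphism `h` of the source: if `R` is a right inverse of the derivative `A`,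
then `h x = x + R (f x - f p - A (x - p))` has derivative `id` at `p`. -/
theorem ContDiffAt.exists_straightening {E F : Type*} [NormedAddCommGroup E] [NormedSpace ℝ E]
    [CompleteSpace E] [NormedAddCommGroup F] [NormedSpace ℝ F] [FiniteDimensional ℝ F]
    {f : E → F} {p : E} (hf : ContDiffAt ℝ ∞ f p) {A : E →L[ℝ] F} (hA : HasFDerivAt f A p)
    (hsurj : Function.Surjective A) :
    ∃ h : OpenPartialHomeomorph E E, p ∈ h.source ∧ h p = p ∧ ContDiffAt ℝ ∞ h.symm p ∧
      ∀ x, f x = f p + A (h x - p) := by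
  obtain ⟨R, hR⟩ := A.exists_rightInverse_of_surjective (LinearMap.range_eq_top.2 hsurj)
  have hAR : ∀ z, A (R z) = z := fun z => DFunLike.congr_fun hR z
  let g : E → E := fun x => x + R (f x - f p - A (x - p))
  have hg : ContDiffAt ℝ ∞ g p := contDiffAt_id.add
    (R.contDiff.contDiffAt.comp p
      ((hf.sub contDiffAt_const).sub
        (A.contDiff.contDiffAt.comp p (contDiffAt_id.sub contDiffAt_const))))
  have hg' : HasFDerivAt g ((ContinuousLinearEquiv.refl ℝ E : E ≃L[ℝ] E) : E →L[ℝ] E) p := by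
    have h1 : HasFDerivAt (fun x => f x - f p - A (x - p)) (A - A) p :=
      (hA.sub_const (f p)).sub (A.hasFDerivAt.comp p ((hasFDerivAt_id p).sub_const p))
    refine ((hasFDerivAt_id p).add (R.hasFDerivAt.comp p h1)).congr_fderiv ?_
    ext z
    simp
  have hn : (∞ : WithTop ℕ∞) ≠ 0 := by simp
  have hgp : g p = p := by simp [g]
  refine ⟨hg.toOpenPartialHomeomorph g hg' hn, hg.mem_toOpenPartialHomeomorph_source hg' hn,
    hgp, ?_, fun x => ?_⟩
  · have := hg.to_localInverse hg' hn
    rwa [hgp] at this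
  · change f x = f p + A (x + R (f x - f p - A (x - p)) - p)
    rw [map_sub, map_add, hAR, map_sub]
    abel

section Submersion

variable {n m : ℕ} {X Y : Type*}
    [TopologicalSpace X] [ChartedSpace (EuclideanSpace ℝ (Fin n)) X]
    [TopologicalSpace Y] [ChartedSpace (EuclideanSpace ℝ (Fin m)) Y]
    {π : X → Y}

/-- The straightening of a submersion at `x₀`, in charts: near `x₀` the map `π` is an affine map
composed with a local homeomorphism of the model space. -/
theorem exists_chart_straightening (hπ : ContMDiff (𝓡 n) (𝓡 m) ∞ π) {x₀ : X}
    (hsubm : Function.Surjective (mfderiv (𝓡 n) (𝓡 m) π x₀)) :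
    ∃ (A : EuclideanSpace ℝ (Fin n) →L[ℝ] EuclideanSpace ℝ (Fin m))
      (h : OpenPartialHomeomorph (EuclideanSpace ℝ (Fin n)) (EuclideanSpace ℝ (Fin n))),
      Function.Surjective A ∧ extChartAt (𝓡 n) x₀ x₀ ∈ h.source ∧
      h (extChartAt (𝓡 n) x₀ x₀) = extChartAt (𝓡 n) x₀ x₀ ∧
      ContDiffAt ℝ ∞ h.symm (extChartAt (𝓡 n) x₀ x₀) ∧
      ∀ p, extChartAt (𝓡 m) (π x₀) (π ((extChartAt (𝓡 n) x₀).symm p)) =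
        extChartAt (𝓡 m) (π x₀) (π x₀) + A (h p - extChartAt (𝓡 n) x₀ x₀) := by
  have hf : ContDiffAt ℝ ∞ (writtenInExtChartAt (𝓡 n) (𝓡 m) x₀ π) (extChartAt (𝓡 n) x₀ x₀) := by
    have := (contMDiffAt_iff.1 (hπ x₀)).2
    rwa [ModelWithCorners.range_eq_univ, contDiffWithinAt_univ] at this
  let A : EuclideanSpace ℝ (Fin n) →L[ℝ] EuclideanSpace ℝ (Fin m) := mfderiv (𝓡 n) (𝓡 m) π x₀
  have hd : HasFDerivAt (writtenInExtChartAt (𝓡 n) (𝓡 m) x₀ π) A (extChartAt (𝓡 n) x₀ x₀) := by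
    have : HasFDerivWithinAt (writtenInExtChartAt (𝓡 n) (𝓡 m) x₀ π) A (range (𝓡 n))
      (extChartAt (𝓡 n) x₀ x₀) := ((hπ x₀).mdifferentiableAt (by simp)).hasMFDerivAt.2
    exact this.hasFDerivAt (by simp)
  obtain ⟨h, h1, h2, h3, h4⟩ := hf.exists_straightening hd hsubm
  refine ⟨A, h, hsubm, h1, h2, h3, fun p => ?_⟩
  have := h4 p
  simpa [writtenInExtChartAt] using this

variable [IsManifold (𝓡 n) ∞ X]

theorem exists_local_section [IsManifold (𝓡 m) ∞ Y] (hπ : ContMDiff (𝓡 n) (𝓡 m) ∞ π) {x₀ : X}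
    (hsubm : Function.Surjective (mfderiv (𝓡 n) (𝓡 m) π x₀)) :
    ∃ s : Y → X, s (π x₀) = x₀ ∧ ContMDiffAt (𝓡 m) (𝓡 n) ∞ s (π x₀) ∧
      ∀ᶠ y in nhds (π x₀), π (s y) = y := by
  obtain ⟨A, h, hA, hp, hpp, hsm, hform⟩ := exists_chart_straightening hπ hsubm
  obtain ⟨R, hR⟩ := A.exists_rightInverse_of_surjective (LinearMap.range_eq_top.2 hA)
  have hAR : ∀ z, A (R z) = z := fun z => DFunLike.congr_fun hR z
  set φ := extChartAt (𝓡 n) x₀ with hφ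
  set ψ := extChartAt (𝓡 m) (π x₀) with hψ
  let l : Y → EuclideanSpace ℝ (Fin n) := fun y => φ x₀ + R (ψ y - ψ (π x₀))
  have hl0 : l (π x₀) = φ x₀ := by simp [l]
  have hsymm0 : h.symm (φ x₀) = φ x₀ := by
    conv_lhs => rw [← hpp]
    exact h.left_inv hp
  -- the section is `y ↦ φ x₀ + R (ψ y - ψ (π x₀))`, read in the straightened coordinates
  have hl : ContMDiffAt (𝓡 m) 𝓘(ℝ, EuclideanSpace ℝ (Fin n)) ∞ l (π x₀) := by
    have hsm : ContDiff ℝ ∞ fun z => φ x₀ + R (z - ψ (π x₀)) :=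
      contDiff_const.add (R.contDiff.comp (contDiff_id.sub contDiff_const))
    exact hsm.contMDiff.contMDiffAt.comp (π x₀) contMDiffAt_extChartAt
  have hhl : ContMDiffAt (𝓡 m) 𝓘(ℝ, EuclideanSpace ℝ (Fin n)) ∞ (h.symm ∘ l) (π x₀) :=
    ContMDiffAt.comp (π x₀) (by rw [hl0]; exact hsm.contMDiffAt) hl
  have hφs : ContMDiffAt 𝓘(ℝ, EuclideanSpace ℝ (Fin n)) (𝓡 n) ∞ φ.symm (φ x₀) :=
    (contMDiffOn_extChartAt_symm x₀).contMDiffAt (extChartAt_target_mem_nhds x₀)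
  have hs : ContMDiffAt (𝓡 m) (𝓡 n) ∞ (φ.symm ∘ (h.symm ∘ l)) (π x₀) :=
    ContMDiffAt.comp (π x₀) (by simpa [hl0, hsymm0] using hφs) hhl
  have hs0 : (φ.symm ∘ (h.symm ∘ l)) (π x₀) = x₀ := by
    simp only [Function.comp_apply, hl0, hsymm0]
    exact extChartAt_to_inv x₀
  refine ⟨φ.symm ∘ (h.symm ∘ l), hs0, hs, ?_⟩
  have hcont : ContinuousAt (π ∘ (φ.symm ∘ (h.symm ∘ l))) (π x₀) :=
    (hπ.continuous.continuousAt).comp hs.continuousAt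
  have h1 : ∀ᶠ y in nhds (π x₀), (π ∘ (φ.symm ∘ (h.symm ∘ l))) y ∈ ψ.source :=
    hcont.eventually_mem (by
      rw [Function.comp_apply, hs0]
      exact extChartAt_source_mem_nhds (π x₀))
  have h2 : ∀ᶠ y in nhds (π x₀), l y ∈ h.target :=
    hl.continuousAt.eventually_mem (by
      rw [hl0]
      refine h.open_target.mem_nhds ?_
      simpa [hpp] using h.map_source hp)
  filter_upwards [h1, h2, extChartAt_source_mem_nhds (I := 𝓡 m) (π x₀)] with y hy1 hy2 hy3
  refine ψ.injOn hy1 hy3 ?_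
  have := hform (h.symm (l y))
  rw [h.right_inv hy2] at this
  simp only [Function.comp_apply]
  rw [this]
  simp [l, hAR]

/-- Points in the same fibre of a submersion that are near to each other can be joined by a
differentiable path inside the fibre which stays in a prescribed neighbourhood. The path runs from
time `0` to time `1`; it is controlled on the larger open interval `(-2, 2)`, which gives two-sided
derivatives at both ends. -/
theorem eventually_exists_path_in_fibre (hπ : ContMDiff (𝓡 n) (𝓡 m) ∞ π) {x₀ : X}
    (hsubm : Function.Surjective (mfderiv (𝓡 n) (𝓡 m) π x₀)) {U : Set X} (hU : U ∈ nhds x₀) :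
    ∀ᶠ x in nhds x₀, π x = π x₀ → ∃ c : ℝ → X, c 0 = x₀ ∧ c 1 = x ∧
      ∀ τ ∈ Ioo (-2 : ℝ) 2, c τ ∈ U ∧ π (c τ) = π x₀ ∧
        MDifferentiableAt 𝓘(ℝ, ℝ) (𝓡 n) c τ := by
  obtain ⟨A, h, -, hp, hpp, hsm, hform⟩ := exists_chart_straightening hπ hsubm
  set φ := extChartAt (𝓡 n) x₀ with hφ
  set ψ := extChartAt (𝓡 m) (π x₀) with hψ
  have hsymm0 : h.symm (φ x₀) = φ x₀ := by
    conv_lhs => rw [← hpp]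
    exact h.left_inv hp
  have hinv0 : φ.symm (φ x₀) = x₀ := extChartAt_to_inv x₀
  have hc1 : ContinuousAt (fun z => φ.symm (h.symm z)) (φ x₀) := by
    refine ContinuousAt.comp (g := φ.symm) ?_ hsm.continuousAt
    rw [hsymm0]
    exact continuousAt_extChartAt_symm x₀
  have hnear : ∀ᶠ z in nhds (φ x₀), z ∈ h.target ∧ h.symm z ∈ φ.target ∧
      φ.symm (h.symm z) ∈ U ∧ π (φ.symm (h.symm z)) ∈ ψ.source ∧
      DifferentiableAt ℝ h.symm z := by
    have htar : ∀ᶠ z in nhds (φ x₀), z ∈ h.target :=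
      h.open_target.mem_nhds (by simpa [hpp] using h.map_source hp)
    refine htar.and ((hsm.continuousAt.eventually_mem ?_).and ((hc1.eventually_mem ?_).and
      ((ContinuousAt.eventually_mem (f := fun z => π (φ.symm (h.symm z)))
        (hπ.continuous.continuousAt.comp hc1) ?_).and ?_)))
    · rw [hsymm0]
      exact extChartAt_target_mem_nhds x₀
    · rwa [hsymm0, hinv0]
    · rw [hsymm0, hinv0]
      exact extChartAt_source_mem_nhds (π x₀)
    · exact ((hsm.of_le (m := 1) (by simp)).eventually (by simp)).mono
        fun z hz => hz.differentiableAt (by simp)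
  obtain ⟨ρ, hρ, hball⟩ := Metric.eventually_nhds_iff_ball.1 hnear
  have hc2 : ContinuousAt (fun x => h (φ x)) x₀ :=
    ContinuousAt.comp (g := h) (h.continuousAt hp) (continuousAt_extChartAt x₀)
  have hx1 : ∀ᶠ x in nhds x₀, h (φ x) ∈ Metric.ball (φ x₀) (ρ / 2) :=
    hc2.eventually_mem (by rw [hpp]; exact Metric.ball_mem_nhds _ (by linarith))
  have hx2 : ∀ᶠ x in nhds x₀, φ x ∈ h.source :=
    (continuousAt_extChartAt x₀).eventually_mem (h.open_source.mem_nhds hp)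
  filter_upwards [hx1, hx2, extChartAt_source_mem_nhds (I := 𝓡 n) x₀] with x hx1 hx2 hx3 hfib
  -- the path is a straight line in the straightened coordinates
  set d := h (φ x) - φ x₀ with hd
  have hAd : A d = 0 := by
    have := hform (φ x)
    rw [φ.left_inv hx3, hfib] at this
    exact left_eq_add.1 this
  have hline : ∀ τ ∈ Ioo (-2 : ℝ) 2, φ x₀ + τ • d ∈ Metric.ball (φ x₀) ρ := by
    intro τ hτ
    have h1 : ‖d‖ < ρ / 2 := by simpa [dist_eq_norm] using hx1
    have h2 : |τ| < 2 := abs_lt.2 hτ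
    rw [Metric.mem_ball, dist_eq_norm, add_sub_cancel_left, norm_smul, Real.norm_eq_abs]
    nlinarith [norm_nonneg d, abs_nonneg τ]
  refine ⟨fun τ => φ.symm (h.symm (φ x₀ + τ • d)), ?_, ?_, fun τ hτ => ?_⟩
  · simp [hsymm0, hinv0]
  · simp [hd, h.left_inv hx2, φ.left_inv hx3]
  · obtain ⟨h1, h2, h3, h4, h5⟩ := hball _ (hline τ hτ)
    refine ⟨h3, ψ.injOn h4 (mem_extChartAt_source _) ?_, ?_⟩
    · rw [hform, h.right_inv h1]
      simp [hAd]
    · have hl : DifferentiableAt ℝ (fun τ : ℝ => φ x₀ + τ • d) τ := by fun_prop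
      have h6 : DifferentiableAt ℝ (fun τ : ℝ => h.symm (φ x₀ + τ • d)) τ := h5.comp τ hl
      have h7 : MDifferentiableAt 𝓘(ℝ, EuclideanSpace ℝ (Fin n)) (𝓡 n) φ.symm
          (h.symm (φ x₀ + τ • d)) :=
        ((contMDiffOn_extChartAt_symm (n := ∞) x₀).contMDiffAt
          ((isOpen_extChartAt_target x₀).mem_nhds h2)).mdifferentiableAt (by simp)
      exact h7.comp τ h6.mdifferentiableAt

end Submersion

/-! ### Lumpability and invariance of the vertical distribution -/

section Lumping

variable {n m : ℕ} {X Y : Type*}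
    [TopologicalSpace X] [T2Space X]
    [ChartedSpace (EuclideanSpace ℝ (Fin n)) X] [IsManifold (𝓡 n) ∞ X]
    [TopologicalSpace Y] [ChartedSpace (EuclideanSpace ℝ (Fin m)) Y]
    {v : (x : X) → TangentSpace (𝓡 n) x} {π : X → Y}

theorem hasMFDerivAt_comp_flow_time (hv : IsSmoothVectorField v)
    (hπ : ContMDiff (𝓡 n) (𝓡 m) ∞ π) {t : ℝ} {x : X} (h : (t, x) ∈ flowDomain v) :
    HasMFDerivAt 𝓘(ℝ, ℝ) (𝓡 m) (fun s => π (flow v s x)) t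
      ((1 : ℝ →L[ℝ] ℝ).smulRight
        (mfderiv (𝓡 n) (𝓡 m) π (flow v t x) (v (flow v t x)))) := by
  have := ((hπ.mdifferentiable (by simp)) (flow v t x)).hasMFDerivAt.comp t
    (hasMFDerivAt_flow_time hv h)
  refine this.congr_mfderiv ?_
  exact ContinuousLinearMap.ext fun c : ℝ =>
    map_smul (mfderiv (𝓡 n) (𝓡 m) π (flow v t x)) c (v (flow v t x))

theorem zero_mem_flowDomain (hv : IsSmoothVectorField v) (x : X) : (0, x) ∈ flowDomain v := by
  obtain ⟨U, -, hxU, ε, hε, hloc⟩ := exists_uniform_time_mdifferentiableAt_flow hv x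
  exact (hloc x hxU 0 ⟨by linarith, hε⟩).1

theorem flow_zero (hv : IsSmoothVectorField v) (x : X) : flow v 0 x = x := by
  obtain ⟨γ, a, b, hγ⟩ := zero_mem_flowDomain hv x
  rw [flow_eq_of_isIntegralCurveFrom hv hγ, hγ.2.2.1]

variable [T2Space Y] [IsManifold (𝓡 m) ∞ Y]

/-- If the system is lumpable, then `π` carries the orbits of `v` to orbits of the reduced vector
field. -/
theorem flow_comp_eq_of_hasMFDerivAt (hv : IsSmoothVectorField v)
    {v' : (y : Y) → TangentSpace (𝓡 m) y} (hv' : IsSmoothVectorField v')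
    (h : ∀ (x : X) (s : ℝ), (s, x) ∈ flowDomain v →
      HasMFDerivAt 𝓘(ℝ, ℝ) (𝓡 m) (fun t => π (flow v t x)) s
        ((1 : ℝ →L[ℝ] ℝ).smulRight (v' (π (flow v s x)))))
    {t : ℝ} {x : X} (ht : (t, x) ∈ flowDomain v) :
    (t, π x) ∈ flowDomain v' ∧ flow v' t (π x) = π (flow v t x) := by
  obtain ⟨γ, a, b, hγ⟩ := ht
  have hcurve : IsIntegralCurveFrom v' (π x) t (fun s => π (flow v s x)) a b :=
    ⟨hγ.1, hγ.2.1, congrArg π (flow_zero hv x),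
      fun s hs => (h x s (hγ.of_mem hs).mem_flowDomain).hasMFDerivWithinAt⟩
  exact ⟨hcurve.mem_flowDomain, flow_eq_of_isIntegralCurveFrom hv' hcurve⟩

/-- Lumpability implies invariance: differentiate `Ψ_t ∘ π = π ∘ Φ_t`, where `Ψ` is the flow of the
reduced vector field. -/
theorem IsExactlyLumpable.isFlowInvariant (hv : IsSmoothVectorField v)
    (hπ : ContMDiff (𝓡 n) (𝓡 m) ∞ π) (h : IsExactlyLumpable n m v π) :
    IsFlowInvariant v (verticalSpace n m π) := by
  obtain ⟨v', hv', hlump⟩ := h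
  intro t x ht w hw
  have hw : mfderiv (𝓡 n) (𝓡 m) π x w = 0 := hw
  obtain ⟨hdom, hdiff⟩ := eventually_mem_flowDomain_and_mdifferentiableAt hv ht
  have hπd : ∀ x, MDifferentiableAt (𝓡 n) (𝓡 m) π x := hπ.mdifferentiable (by simp)
  have hΨ := (eventually_mem_flowDomain_and_mdifferentiableAt hv'
    (flow_comp_eq_of_hasMFDerivAt hv hv' hlump ht).1).2
  have hcomm : π ∘ flow v t =ᶠ[nhds x] flow v' t ∘ π := by
    filter_upwards [hdom] with y hy
    exact (flow_comp_eq_of_hasMFDerivAt hv hv' hlump hy).2.symm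
  have h1 : HasMFDerivAt (𝓡 n) (𝓡 m) (π ∘ flow v t) x _ :=
    (hπd (flow v t x)).hasMFDerivAt.comp x hdiff.hasMFDerivAt
  have h2 : HasMFDerivAt (𝓡 n) (𝓡 m) (π ∘ flow v t) x _ :=
    (hΨ.hasMFDerivAt.comp x (hπd x).hasMFDerivAt).congr_of_eventuallyEq hcomm
  have h3 := DFunLike.congr_fun (hasMFDerivAt_unique h1 h2) w
  change mfderiv (𝓡 n) (𝓡 m) π (flow v t x) (mfderiv (𝓡 n) (𝓡 n) (flow v t) x w) = 0
  refine h3.trans ?_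
  change mfderiv (𝓡 m) (𝓡 m) (flow v' t) (π x) (mfderiv (𝓡 n) (𝓡 m) π x w) = 0
  rw [hw, map_zero]

/-- A curve with vanishing derivative on an open interval is constant there: it is an integral
curve of the zero vector field. -/
theorem eq_of_hasMFDerivAt_zero {q : ℝ → Y} {a b : ℝ}
    (hq : ∀ τ ∈ Ioo a b, HasMFDerivAt 𝓘(ℝ, ℝ) (𝓡 m) q τ 0) {s t : ℝ} (hs : s ∈ Ioo a b)
    (ht : t ∈ Ioo a b) : q s = q t := by
  have hsmooth : ContMDiff (𝓡 m) (𝓡 m).tangent 1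
      (fun y : Y => (⟨y, 0⟩ : TangentBundle (𝓡 m) Y)) :=
    Bundle.contMDiff_zeroSection ℝ (TangentSpace (𝓡 m) : Y → Type _)
  have hcurve : IsMIntegralCurveOn q (fun _ : Y => (0 : TangentSpace (𝓡 m) _)) (Ioo a b) :=
    fun τ hτ => ((hq τ hτ).congr_mfderiv 
      (ContinuousLinearMap.ext fun c : ℝ => (smul_zero c).symm)).hasMFDerivWithinAt
  have hconst : IsMIntegralCurveOn (fun _ => q s) (fun _ : Y => (0 : TangentSpace (𝓡 m) _))
      (Ioo a b) := (isMIntegralCurve_const (x := q s) rfl).isMIntegralCurveOn _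
  exact (isMIntegralCurveOn_Ioo_eqOn_of_contMDiff_boundaryless hs hsmooth hcurve hconst rfl ht).symm

/-- If the vertical distribution is invariant, then the projected velocity `Dπ(v)` is locally
constant along the fibres: for small times `π ∘ Φ_t` is constant on the fibre near a point, since
its derivative along paths in the fibre vanishes; differentiating in time at `0` gives the
claim. -/
theorem eventually_mfderiv_apply_eq_of_isFlowInvariant (hv : IsSmoothVectorField v)
    (hπ : ContMDiff (𝓡 n) (𝓡 m) ∞ π) (hinv : IsFlowInvariant v (verticalSpace n m π)) {x₀ : X}
    (hsubm : Function.Surjective (mfderiv (𝓡 n) (𝓡 m) π x₀)) :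
    ∀ᶠ x in nhds x₀, π x = π x₀ →
      (mfderiv (𝓡 n) (𝓡 m) π x (v x) : EuclideanSpace ℝ (Fin m)) =
        (mfderiv (𝓡 n) (𝓡 m) π x₀ (v x₀) : EuclideanSpace ℝ (Fin m)) := by
  obtain ⟨U, hU, hx₀U, ε, hε, hloc⟩ := exists_uniform_time_mdifferentiableAt_flow hv x₀
  have hπd : ∀ x, MDifferentiableAt (𝓡 n) (𝓡 m) π x := hπ.mdifferentiable (by simp)
  filter_upwards [eventually_exists_path_in_fibre hπ hsubm (hU.mem_nhds hx₀U)] with x hx hfib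
  obtain ⟨c, hc0, hc1, hc⟩ := hx hfib
  have hconst : ∀ t ∈ Ioo (-ε) ε, π (flow v t x) = π (flow v t x₀) := by
    intro t ht
    have hzero : ∀ τ ∈ Ioo (-2 : ℝ) 2,
        HasMFDerivAt 𝓘(ℝ, ℝ) (𝓡 m) (fun τ => π (flow v t (c τ))) τ 0 := by
      intro τ hτ
      obtain ⟨hτU, -, hτd⟩ := hc τ hτ
      obtain ⟨hdom, hΦ⟩ := hloc _ hτU t ht
      -- the velocity of the path is vertical
      have hvert : (mfderiv (𝓡 n) (𝓡 m) π (c τ)).comp (mfderiv 𝓘(ℝ, ℝ) (𝓡 n) c τ) = 0 := by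
        refine hasMFDerivAt_unique ((hπd (c τ)).hasMFDerivAt.comp τ hτd.hasMFDerivAt) ?_
        refine (hasMFDerivAt_const (π x₀) τ).congr_of_eventuallyEq ?_
        filter_upwards [Ioo_mem_nhds hτ.1 hτ.2] with σ hσ
        exact (hc σ hσ).2.1
      refine ((hπd (flow v t (c τ))).hasMFDerivAt.comp τ
        (hΦ.hasMFDerivAt.comp τ hτd.hasMFDerivAt)).congr_mfderiv ?_
      exact ContinuousLinearMap.ext fun r => hinv t (c τ) hdom (mfderiv 𝓘(ℝ, ℝ) (𝓡 n) c τ r)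
        (DFunLike.congr_fun hvert r)
    have := eq_of_hasMFDerivAt_zero hzero (s := 1) (t := 0) (by norm_num) (by norm_num)
    simpa only [hc0, hc1] using this
  have h0 : ∀ᶠ t in nhds (0 : ℝ), π (flow v t x) = π (flow v t x₀) := by
    filter_upwards [Ioo_mem_nhds (show -ε < 0 by linarith) hε] with t ht using hconst t ht
  have h1 := hasMFDerivAt_comp_flow_time hv hπ (zero_mem_flowDomain hv x)
  have h2 := (hasMFDerivAt_comp_flow_time hv hπ
    (zero_mem_flowDomain hv x₀)).congr_of_eventuallyEq h0
  rw [flow_zero hv] at h1 h2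
  have h3 := DFunLike.congr_fun (hasMFDerivAt_unique h1 h2) (1 : ℝ)
  have h4 : (1 : ℝ) • (mfderiv (𝓡 n) (𝓡 m) π x (v x) : EuclideanSpace ℝ (Fin m)) =
    (1 : ℝ) • (mfderiv (𝓡 n) (𝓡 m) π x₀ (v x₀) : EuclideanSpace ℝ (Fin m)) := h3
  simpa using h4

/-- Invariance implies lumpability if the fibres are connected: the projected velocity is then
constant on each fibre, so that it descends to a vector field on the base, which is smooth because
`π` has smooth local sections. -/
theorem IsFlowInvariant.isExactlyLumpable (hv : IsSmoothVectorField v)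
    (hπ : ContMDiff (𝓡 n) (𝓡 m) ∞ π) (hsurj : Function.Surjective π)
    (hsubm : ∀ x, Function.Surjective (mfderiv (𝓡 n) (𝓡 m) π x))
    (hconn : ∀ y, IsPreconnected (π ⁻¹' {y}))
    (hinv : IsFlowInvariant v (verticalSpace n m π)) : IsExactlyLumpable n m v π := by
  have hfib : ∀ x x' : X, π x = π x' →
      (mfderiv (𝓡 n) (𝓡 m) π x (v x) : EuclideanSpace ℝ (Fin m)) =
        (mfderiv (𝓡 n) (𝓡 m) π x' (v x') : EuclideanSpace ℝ (Fin m)) := by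
    intro x x' hxx'
    refine (hconn (π x')).induction₂ (fun x x' : X =>
      (mfderiv (𝓡 n) (𝓡 m) π x (v x) : EuclideanSpace ℝ (Fin m)) =
        (mfderiv (𝓡 n) (𝓡 m) π x' (v x') : EuclideanSpace ℝ (Fin m))) (fun z hz => ?_)
      (fun _ _ _ _ _ _ h₁ h₂ => h₁.trans h₂) (fun _ _ _ _ h => h.symm) hxx' rfl
    filter_upwards [nhdsWithin_le_nhds
      (eventually_mfderiv_apply_eq_of_isFlowInvariant hv hπ hinv (hsubm z)),
      self_mem_nhdsWithin] with z' hz' hmem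
    exact (hz' (Eq.trans hmem (Eq.symm hz))).symm
  obtain ⟨σ, hσ⟩ := hsurj.hasRightInverse
  -- `Dπ(v)` at a chosen point of the fibre; tangent spaces at `π (σ y)` and at `y` are both the
  -- model space, in the chart preferred at their base point, and `π (σ y) = y`
  let v' : (y : Y) → TangentSpace (𝓡 m) y := fun y =>
    (mfderiv (𝓡 n) (𝓡 m) π (σ y) (v (σ y)) : EuclideanSpace ℝ (Fin m))
  have hv'π : ∀ x, v' (π x) = mfderiv (𝓡 n) (𝓡 m) π x (v x) := fun x =>
    hfib (σ (π x)) x (hσ (π x))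
  have htan : ∀ x, (⟨π x, v' (π x)⟩ : TangentBundle (𝓡 m) Y) =
      tangentMap (𝓡 n) (𝓡 m) π ⟨x, v x⟩ := fun x => by
    rw [hv'π]
    rfl
  refine ⟨v', fun y => ?_, fun x s hs => ?_⟩
  · obtain ⟨x, rfl⟩ := hsurj y
    obtain ⟨s, hsx, hs, hsec⟩ := exists_local_section hπ (hsubm x)
    have hsm : ContMDiffAt (𝓡 m) (𝓡 m).tangent ∞
        (fun y => tangentMap (𝓡 n) (𝓡 m) π (⟨s y, v (s y)⟩ : TangentBundle (𝓡 n) X)) (π x) :=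
      ((hπ.contMDiff_tangentMap (m := ∞) (by simp)).comp hv).contMDiffAt.comp (π x) hs
    refine hsm.congr_of_eventuallyEq ?_
    filter_upwards [hsec] with y hy
    rw [← htan, hy]
  · rw [hv'π]
    exact hasMFDerivAt_comp_flow_time hv hπ hs

end Lumping
theorem mainTheorem2 {n m : ℕ} {X Y : Type*}
    [TopologicalSpace X] [T2Space X] [SecondCountableTopology X]
    [ChartedSpace (EuclideanSpace ℝ (Fin n)) X] [IsManifold (𝓡 n) ∞ X]
    [TopologicalSpace Y] [T2Space Y] [SecondCountableTopology Y]
    [ChartedSpace (EuclideanSpace ℝ (Fin m)) Y] [IsManifold (𝓡 m) ∞ Y]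
    (v : (x : X) → TangentSpace (𝓡 n) x) (hv : IsSmoothVectorField v)
    (π : X → Y) (hπ : ContMDiff (𝓡 n) (𝓡 m) ∞ π) (hsurj : Function.Surjective π)
    (hsubm : ∀ x, Function.Surjective (mfderiv (𝓡 n) (𝓡 m) π x)) :
    (IsExactlyLumpable n m v π → IsFlowInvariant v (verticalSpace n m π)) ∧
    ((∀ y, IsConnected (π ⁻¹' {y})) →
      (IsExactlyLumpable n m v π ↔ IsFlowInvariant v (verticalSpace n m π))) := by
  have hforward : IsExactlyLumpable n m v π → IsFlowInvariant v (verticalSpace n m π) :=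
    fun h => h.isFlowInvariant hv hπ
  exact ⟨hforward, fun hconn => ⟨hforward, fun hinv =>
    hinv.isExactlyLumpable hv hπ hsurj hsubm fun y => (hconn y).isPreconnected⟩⟩
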